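/- Let $\gamma,\delta>-\tfrac12$ be real numbers, let $\mu\ge 1$ be an integer, and let $g_1,g_2$ be real-valued functions that are analytic on $[-1,1]$. Let $$f(x)=(1-x)^{\gamma}\ln^{\mu}(1-x)\,g_1(x)+(1+x)^{\delta}\ln^{\mu}(1+x)\,g_2(x),\qquad x\in(-1,1),$$ and let $$a_k=\frac{2}{\pi}\int_{-1}^{1}\frac{f(x)\,T_k(x)}{\sqrt{1-x^2}}\,dx,\qquad k=0,1,2,\dots,$$ be its Chebyshev coefficients, where $T_k(x)=\cos(k\arccos x)$. These integrals converge absolutely, and, as $k\to\infty$ (with $\gamma,\delta,\mu,g_1,g_2$ fixed), $$|a_k|=\begin{cases} O\!\left(\dfrac{\ln^{\mu}k}{k^{\min\{2\gamma+1,\,2\delta+1\}}}\right), & \gamma\notin\mathbb{Z}_+,\ \delta\notin\mathbb{Z}_+,\\[2ex] O\!\left(\dfrac{\ln^{\mu-1}k}{k^{\min\{2\gamma+1,\,2\delta+1\}}}\right), & \gamma\in\mathbb{Z}_+,\ \delta\in\mathbb{Z}_+,\\[2ex] O\!\left(\max\left\{\dfrac{\ln^{\mu-1}k}{k^{2\gamma+1}},\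 \dfrac{\ln^{\mu}k}{k^{2\delta+1}}\right\}\right), & \gamma\in\mathbb{Z}_+,\ \delta\notin\mathbb{Z}_+,\\[2ex] O\!\left(\max\left\{\dfrac{\ln^{\mu}k}{k^{2\gamma+1}},\ \dfrac{\ln^{\mu-1}k}{k^{2\delta+1}}\right\}\right), & \gamma\notin\mathbb{Z}_+,\ \delta\in\mathbb{Z}_+, \end{cases}$$ where $\mathbb{Z}_+=\{1,2,3,\dots\}$. -/

import Mathlib

open Filter Asymptotics

/-- The function `f(x) = (1-x)^γ ln^μ(1-x) g₁(x) + (1+x)^δ ln^μ(1+x) g₂(x)`. -/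
noncomputable def logSingularFun (γ δ : ℝ) (μ : ℕ) (g₁ g₂ : ℝ → ℝ) (x : ℝ) : ℝ :=
  (1 - x) ^ γ * Real.log (1 - x) ^ μ * g₁ x + (1 + x) ^ δ * Real.log (1 + x) ^ μ * g₂ x

/-- The integrand `f(x) T_k(x) / √(1 - x²)` of the `k`-th Chebyshev coefficient. -/
noncomputable def chebyshevIntegrand (f : ℝ → ℝ) (k : ℕ) (x : ℝ) : ℝ :=
  f x * (Polynomial.Chebyshev.T ℝ (k : ℤ)).eval x * (1 / Real.sqrt (1 - x ^ 2))

/-- The `k`-th Chebyshev coefficient `a_k = (2/π) ∫_{-1}^{1} f(x) T_k(x) / √(1 - x²) dx`. -/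
noncomputable def chebyshevCoeff (f : ℝ → ℝ) (k : ℕ) : ℝ :=
  2 / Real.pi * ∫ x in (-1 : ℝ)..1, chebyshevIntegrand f k x

/-- The real number `x` is a positive integer. -/
def IsPosInteger (x : ℝ) : Prop := ∃ m : ℕ, 0 < m ∧ x = (m : ℝ)

/-! By linearity and the reflection `x ↦ -x`, which multiplies `T_k` by `(-1)^k`, it is enough to
treat the singularity at `x = 1`. Under `x = cos 2φ` one has `1 - x = (√2 sin φ)²`, so the
coefficient becomes a Fourier integral over `(0, π)` with integrand `(sin φ)^(2γ) log(√2 sin φ)^μ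
G(φ) cos 2kφ`, up to a constant factor, where `G` is smooth and `π`-periodic.

The logarithm is measured at the wavelength scale: `log(√2 sin φ) = log(k sin φ) - log(k/√2)`. The
binomial theorem (`singTerm_rescale`) gives powers `log(k/√2)^(μ-j)` times integrals containing
`log(k sin φ)^j`. Each such integral is `O(k^(-2γ-1))` without any logarithm (`singTerm_osc`).
Within `1/k` of the endpoints absolute values suffice. Elsewhere repeated integration by parts
lowers the exponent below `-1`, after which absolute values suffice again. This yields the factor
`log^μ k`.

Only the `j = 0` term carries the full power `log^μ k`. If `γ` is a positive integer, its integrand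
`(sin φ)^(2γ) G` is smooth and `π`-periodic, so its Fourier coefficients decay faster than any power
(`periodic_osc`); the term is negligible and one logarithm is saved. -/

/-! ### The model singularity: derivative and pointwise bounds -/

/-- The model singular function `sin(φ)^a * log(k sin φ)^j * G φ` at scale `k`. -/
noncomputable def singTerm (a : ℝ) (j : ℕ) (k : ℝ) (G : ℝ → ℝ) (φ : ℝ) : ℝ :=
  Real.sin φ ^ a * Real.log (k * Real.sin φ) ^ j * G φ

lemma singTerm_comp_pi_sub (a : ℝ) (j : ℕ) (k : ℝ) (G : ℝ → ℝ) (φ : ℝ) :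
    singTerm a j k G (Real.pi - φ) = singTerm a j k (fun x => G (Real.pi - x)) φ := by
  simp [singTerm, Real.sin_pi_sub]

/-- The model class is closed under differentiation: the exponent drops by one and no power of `k`
appears, since the derivative of `log(k sin φ)` is `cos φ / sin φ`. For `j = 0` the truncated `j -
1` is harmless because its coefficient vanishes. -/
lemma hasDerivAt_singTerm (a : ℝ) (j : ℕ) {k : ℝ} (hk : 0 < k) {G : ℝ → ℝ}
    (hG : Differentiable ℝ G) {φ : ℝ} (hφ : 0 < Real.sin φ) :
    HasDerivAt (singTerm a j k G)
      (singTerm (a - 1) j k (fun x => a * Real.cos x * G x) φ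
        + singTerm (a - 1) (j - 1) k (fun x => j * Real.cos x * G x) φ
        + singTerm (a - 1) j k (fun x => Real.sin x * deriv G x) φ) φ := by
  have h1 : HasDerivAt (fun x => Real.sin x ^ a) (Real.cos φ * a * Real.sin φ ^ (a - 1)) φ :=
    (Real.hasDerivAt_sin φ).rpow_const (Or.inl hφ.ne')
  have h2 : HasDerivAt (fun x => Real.log (k * Real.sin x)) (k * Real.cos φ / (k * Real.sin φ)) φ :=
    ((Real.hasDerivAt_sin φ).const_mul k).log (by positivity)
  have h3 := (h1.mul (h2.pow j)).mul (hG φ).hasDerivAt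
  refine h3.congr_deriv ?_
  have hs : Real.sin φ ^ a = Real.sin φ ^ (a - 1) * Real.sin φ := by
    rw [Real.rpow_sub_one hφ.ne']; field_simp
  simp only [singTerm, Pi.pow_apply, Pi.mul_apply, hs]
  field_simp

lemma continuousOn_singTerm (a : ℝ) (j : ℕ) {k : ℝ} (hk : 0 < k) {G : ℝ → ℝ}
    (hG : Continuous G) {s : Set ℝ} (hs : ∀ φ ∈ s, 0 < Real.sin φ) :
    ContinuousOn (singTerm a j k G) s := by
  unfold singTerm
  refine ((Real.continuous_sin.continuousOn.rpow_const fun x hx => Or.inl (hs x hx).ne').mul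
    (ContinuousOn.pow (ContinuousOn.log (by fun_prop) fun x hx => ?_) j)).mul hG.continuousOn
  have := hs x hx
  positivity

lemma abs_log_pow_le (j : ℕ) {η : ℝ} (hη : 0 < η) :
    ∃ C, 0 ≤ C ∧ ∀ u : ℝ, 0 < u → |Real.log u| ^ j ≤ C * (u ^ η + u ^ (-η)) := by
  -- Dividing by `j + 1` rather than `j` covers `j = 0` and still gives `ε * j ≤ η`.
  set ε := η / (j + 1) with hε
  have hε0 : 0 < ε := by positivity
  have hεj : ε * j ≤ η := by
    rw [hε, div_mul_eq_mul_div, div_le_iff₀ (by positivity)]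
    nlinarith
  have key : ∀ u : ℝ, 1 ≤ u → |Real.log u| ^ j ≤ (1 / ε) ^ j * u ^ η := by
    intro u hu
    have hu0 : 0 < u := by linarith
    have h1 : |Real.log u| ≤ 1 / ε * u ^ ε := by
      rw [abs_of_nonneg (Real.log_nonneg hu)]
      have := Real.log_le_rpow_div hu0.le hε0
      rwa [one_div, inv_mul_eq_div]
    calc |Real.log u| ^ j ≤ (1 / ε * u ^ ε) ^ j := by gcongr
      _ = (1 / ε) ^ j * u ^ (ε * j) := by
        rw [mul_pow, ← Real.rpow_natCast (u ^ ε), ← Real.rpow_mul hu0.le]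
      _ ≤ _ := by gcongr
  refine ⟨(1 / ε) ^ j, by positivity, fun u hu => ?_⟩
  rcases le_total 1 u with h | h
  · refine (key u h).trans ?_
    gcongr
    have := Real.rpow_nonneg hu.le (-η)
    linarith
  · have h2 := key u⁻¹ (by rw [one_le_inv₀ hu]; exact h)
    rw [Real.log_inv, abs_neg, Real.inv_rpow hu.le, ← Real.rpow_neg hu.le] at h2
    refine h2.trans ?_
    gcongr
    have := Real.rpow_nonneg hu.le η
    linarith

/-- For `b ≥ 0` this is `sin φ ≤ φ`; for `b ≤ 0` it is Jordan's inequality `2φ/π ≤ sin φ`. The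
constant covers both signs. -/
lemma sin_rpow_le (b : ℝ) {φ : ℝ} (h0 : 0 < φ) (h1 : φ ≤ Real.pi / 2) :
    Real.sin φ ^ b ≤ (1 + (2 / Real.pi) ^ b) * φ ^ b := by
  have hp := Real.pi_pos
  have hs : 0 < Real.sin φ := Real.sin_pos_of_pos_of_lt_pi h0 (by linarith)
  have hφb : 0 < φ ^ b := Real.rpow_pos_of_pos h0 b
  have hpb : 0 < (2 / Real.pi) ^ b := by positivity
  rcases le_total 0 b with hb | hb
  · have : Real.sin φ ^ b ≤ φ ^ b := Real.rpow_le_rpow hs.le (Real.sin_le h0.le) hb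
    nlinarith
  · have : Real.sin φ ^ b ≤ (2 / Real.pi * φ) ^ b :=
      Real.rpow_le_rpow_of_nonpos (by positivity) (Real.mul_le_sin h0.le h1) hb
    rw [Real.mul_rpow (by positivity) h0.le] at this
    nlinarith

/-- The logarithm is traded for the powers `(k sin φ)^(±η)`. At `φ ~ 1/k` both terms on the right
have size `k^(-a)`, so the trade costs no logarithm of `k`; `C` does not depend on `k`. -/
lemma abs_singTerm_le (a : ℝ) (j : ℕ) {G : ℝ → ℝ} (hG : Continuous G) {η : ℝ} (hη : 0 < η) :
    ∃ C, 0 ≤ C ∧ ∀ k : ℝ, 0 < k → ∀ φ, 0 < φ → φ ≤ Real.pi / 2 →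
      |singTerm a j k G φ| ≤ C * (k ^ η * φ ^ (a + η) + k ^ (-η) * φ ^ (a - η)) := by
  obtain ⟨M, hM⟩ := (isCompact_Icc (a := (0 : ℝ)) (b := Real.pi / 2)).exists_bound_of_continuousOn
    hG.continuousOn
  obtain ⟨D, hD0, hD⟩ := abs_log_pow_le j hη
  set A := (1 + (2 / Real.pi) ^ (a + η)) + (1 + (2 / Real.pi) ^ (a - η)) with hA
  have hp := Real.pi_pos
  have hM0 : 0 ≤ M := (norm_nonneg _).trans (hM 0 ⟨le_rfl, by positivity⟩)
  have q1 : 0 < (2 / Real.pi) ^ (a + η) := by positivity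
  have q2 : 0 < (2 / Real.pi) ^ (a - η) := by positivity
  have hA0 : 0 ≤ A := by positivity
  refine ⟨D * A * M, by positivity, fun k hk φ h0 h1 => ?_⟩
  have hs : 0 < Real.sin φ := Real.sin_pos_of_pos_of_lt_pi h0 (by linarith)
  have e1 : Real.sin φ ^ (a + η) ≤ A * φ ^ (a + η) :=
    (sin_rpow_le _ h0 h1).trans (by gcongr; linarith)
  have e2 : Real.sin φ ^ (a - η) ≤ A * φ ^ (a - η) :=
    (sin_rpow_le _ h0 h1).trans (by gcongr; linarith)
  have e3 : Real.sin φ ^ a * ((k * Real.sin φ) ^ η + (k * Real.sin φ) ^ (-η))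
      = k ^ η * Real.sin φ ^ (a + η) + k ^ (-η) * Real.sin φ ^ (a - η) := by
    rw [Real.mul_rpow hk.le hs.le, Real.mul_rpow hk.le hs.le, sub_eq_add_neg,
      Real.rpow_add hs, Real.rpow_add hs]
    ring
  have hGφ : |G φ| ≤ M := hM φ ⟨h0.le, h1⟩
  have hL := hD (k * Real.sin φ) (by positivity)
  unfold singTerm
  rw [abs_mul, abs_mul, abs_pow, abs_of_pos (Real.rpow_pos_of_pos hs a)]
  calc Real.sin φ ^ a * |Real.log (k * Real.sin φ)| ^ j * |G φ|
      ≤ Real.sin φ ^ a * (D * ((k * Real.sin φ) ^ η + (k * Real.sin φ) ^ (-η))) * M := by gcongr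
    _ = D * M * (k ^ η * Real.sin φ ^ (a + η) + k ^ (-η) * Real.sin φ ^ (a - η)) := by
        rw [← e3]; ring
    _ ≤ D * M * (k ^ η * (A * φ ^ (a + η)) + k ^ (-η) * (A * φ ^ (a - η))) := by gcongr
    _ = _ := by ring

/-! ### Absolute bounds on either side of `φ = 1/k` -/

lemma integral_rpow_outer_le {b : ℝ} (hb : b < -1) {k : ℝ} (hk : 1 ≤ k) :
    ∫ φ in (1 / k)..(Real.pi / 2), φ ^ b ≤ 1 / (-b - 1) * k ^ (-b - 1) := by
  have hk0 : 0 < k := by linarith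
  have hik : 1 / k ≤ Real.pi / 2 := by
    have : 1 / k ≤ 1 := by rw [div_le_one hk0]; exact hk
    linarith [Real.pi_gt_three]
  have h0 : (0 : ℝ) ∉ Set.uIcc (1 / k) (Real.pi / 2) := by
    rw [Set.uIcc_of_le hik]
    intro h
    have : 0 < 1 / k := by positivity
    linarith [h.1]
  rw [integral_rpow (Or.inr ⟨hb.ne, h0⟩)]
  have h1 : (1 / k) ^ (b + 1) = k ^ (-b - 1) := by
    rw [one_div, Real.inv_rpow hk0.le, ← Real.rpow_neg hk0.le]; ring_nf
  have h2 : 0 ≤ (Real.pi / 2) ^ (b + 1) := by positivity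
  have h3 : 0 < -b - 1 := by linarith
  rw [h1, show b + 1 = -(-b - 1) by ring, div_neg, ← neg_div, div_mul_eq_mul_div, one_mul]
  gcongr
  linarith [show 0 ≤ (Real.pi / 2) ^ (-(-b - 1)) by positivity]

lemma integral_rpow_inner {b : ℝ} (hb : -1 < b) {k : ℝ} (hk : 1 ≤ k) :
    ∫ φ in (0 : ℝ)..(1 / k), φ ^ b = 1 / (b + 1) * k ^ (-b - 1) := by
  have hk0 : 0 < k := by linarith
  have h3 : b + 1 ≠ 0 := by linarith
  rw [integral_rpow (Or.inl hb), Real.zero_rpow h3, one_div k, Real.inv_rpow hk0.le,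
    ← Real.rpow_neg hk0.le, neg_add']
  ring

/-- Absolute bound away from the singularity, for non-integrable exponents. -/
lemma singTerm_outer_half {a : ℝ} (ha : a < -1) (j : ℕ) {G : ℝ → ℝ} (hG : Continuous G) :
    ∃ C, ∀ k : ℝ, 1 ≤ k → ∀ w : ℝ → ℝ, (∀ x, |w x| ≤ 1) →
      |∫ φ in (1 / k)..(Real.pi / 2), singTerm a j k G φ * w φ| ≤ C * k ^ (-a - 1) := by
  -- Half the gap to `-1`, so that `a + η` also stays below `-1`.
  set η := (-1 - a) / 2 with hη
  have hη0 : 0 < η := by rw [hη]; linarith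
  obtain ⟨C, hC0, hC⟩ := abs_singTerm_le a j hG hη0
  refine ⟨C * (1 / (-(a + η) - 1) + 1 / (-(a - η) - 1)), fun k hk w hw => ?_⟩
  have hk0 : 0 < k := by linarith
  have hik0 : 0 < 1 / k := by positivity
  have hik : 1 / k ≤ Real.pi / 2 := by
    have : 1 / k ≤ 1 := by rw [div_le_one hk0]; exact hk
    linarith [Real.pi_gt_three]
  have h0 : (0 : ℝ) ∉ Set.uIcc (1 / k) (Real.pi / 2) := by
    rw [Set.uIcc_of_le hik]
    intro h
    linarith [h.1]
  have i1 := intervalIntegral.intervalIntegrable_rpow (μ := MeasureTheory.volume)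
    (r := a + η) (Or.inr h0)
  have i2 := intervalIntegral.intervalIntegrable_rpow (μ := MeasureTheory.volume)
    (r := a - η) (Or.inr h0)
  have h1 := intervalIntegral.norm_integral_le_of_norm_le (f := fun φ => singTerm a j k G φ * w φ)
    (g := fun φ => C * (k ^ η * φ ^ (a + η) + k ^ (-η) * φ ^ (a - η)))
    (μ := MeasureTheory.volume) hik
    (Eventually.of_forall fun φ hφ => by
      have := hC k hk0 φ (hik0.trans hφ.1) hφ.2
      rw [norm_mul, Real.norm_eq_abs, Real.norm_eq_abs]
      exact (mul_le_of_le_one_right (abs_nonneg _) (hw φ)).trans this)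
    (((i1.const_mul _).add (i2.const_mul _)).const_mul _)
  refine h1.trans ?_
  rw [intervalIntegral.integral_const_mul, intervalIntegral.integral_add (i1.const_mul _)
    (i2.const_mul _), intervalIntegral.integral_const_mul, intervalIntegral.integral_const_mul]
  have j1 := integral_rpow_outer_le (b := a + η) (by rw [hη]; linarith) hk
  have j2 := integral_rpow_outer_le (b := a - η) (by linarith) hk
  -- The auxiliary `η` cancels: both terms have the same order `k^(-a-1)`.
  have e1 : k ^ (-a - 1) = k ^ η * k ^ (-(a + η) - 1) := by
    rw [← Real.rpow_add hk0]; ring_nf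
  have e2 : k ^ (-a - 1) = k ^ (-η) * k ^ (-(a - η) - 1) := by
    rw [← Real.rpow_add hk0]; ring_nf
  calc _ ≤ C * (k ^ η * (1 / (-(a + η) - 1) * k ^ (-(a + η) - 1))
        + k ^ (-η) * (1 / (-(a - η) - 1) * k ^ (-(a - η) - 1))) := by gcongr
    _ = C * (1 / (-(a + η) - 1) * (k ^ η * k ^ (-(a + η) - 1))
        + 1 / (-(a - η) - 1) * (k ^ (-η) * k ^ (-(a - η) - 1))) := by ring
    _ = _ := by rw [← e1, ← e2]; ring

lemma singTerm_intervalIntegrable_half {a : ℝ} (ha : -1 < a) (j : ℕ) {G : ℝ → ℝ}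
    (hG : Continuous G) {k : ℝ} (hk : 0 < k) :
    IntervalIntegrable (singTerm a j k G) MeasureTheory.volume 0 (Real.pi / 2) := by
  have hη0 : 0 < (a + 1) / 2 := by linarith
  obtain ⟨C, hC0, hC⟩ := abs_singTerm_le a j hG hη0
  have hp := Real.pi_pos
  have i1 := intervalIntegral.intervalIntegrable_rpow' (a := 0) (b := Real.pi / 2)
    (r := a + (a + 1) / 2) (by linarith)
  have i2 := intervalIntegral.intervalIntegrable_rpow' (a := 0) (b := Real.pi / 2)
    (r := a - (a + 1) / 2) (by linarith)
  refine (((i1.const_mul (k ^ ((a + 1) / 2))).add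
    (i2.const_mul (k ^ (-((a + 1) / 2))))).const_mul C).mono_fun' ?_ ?_
  · rw [Set.uIoc_of_le (by positivity)]
    refine ContinuousOn.aestronglyMeasurable (continuousOn_singTerm a j hk hG ?_)
      measurableSet_Ioc
    intro φ hφ
    exact Real.sin_pos_of_pos_of_lt_pi hφ.1 (by linarith [hφ.2])
  · rw [Set.uIoc_of_le (by positivity)]
    refine (MeasureTheory.ae_restrict_iff' measurableSet_Ioc).2 (Eventually.of_forall fun φ hφ => ?_)
    exact hC k hk φ hφ.1 hφ.2

/-- Absolute bound near the singularity, for integrable exponents. -/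
lemma singTerm_inner_half {a : ℝ} (ha : -1 < a) (j : ℕ) {G : ℝ → ℝ} (hG : Continuous G) :
    ∃ C, ∀ k : ℝ, 1 ≤ k → ∀ w : ℝ → ℝ, (∀ x, |w x| ≤ 1) →
      |∫ φ in (0 : ℝ)..(1 / k), singTerm a j k G φ * w φ| ≤ C * k ^ (-a - 1) := by
  -- Half the gap to `-1`, so that `a - η` is still integrable at `0`.
  set η := (a + 1) / 2 with hη
  have hη0 : 0 < η := by rw [hη]; linarith
  obtain ⟨C, hC0, hC⟩ := abs_singTerm_le a j hG hη0
  refine ⟨C * (1 / (a + η + 1) + 1 / (a - η + 1)), fun k hk w hw => ?_⟩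
  have hk0 : 0 < k := by linarith
  have hik0 : 0 < 1 / k := by positivity
  have hik : 1 / k ≤ Real.pi / 2 := by
    have : 1 / k ≤ 1 := by rw [div_le_one hk0]; exact hk
    linarith [Real.pi_gt_three]
  have b1 : -1 < a + η := by linarith
  have b2 : -1 < a - η := by rw [hη]; linarith
  have i1 := intervalIntegral.intervalIntegrable_rpow' (a := 0) (b := 1 / k) b1
  have i2 := intervalIntegral.intervalIntegrable_rpow' (a := 0) (b := 1 / k) b2
  have h1 := intervalIntegral.norm_integral_le_of_norm_le (f := fun φ => singTerm a j k G φ * w φ)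
    (g := fun φ => C * (k ^ η * φ ^ (a + η) + k ^ (-η) * φ ^ (a - η)))
    (μ := MeasureTheory.volume) hik0.le
    (Eventually.of_forall fun φ hφ => by
      have := hC k hk0 φ hφ.1 (hφ.2.trans hik)
      rw [norm_mul, Real.norm_eq_abs, Real.norm_eq_abs]
      exact (mul_le_of_le_one_right (abs_nonneg _) (hw φ)).trans this)
    (((i1.const_mul _).add (i2.const_mul _)).const_mul _)
  refine h1.trans ?_
  rw [intervalIntegral.integral_const_mul, intervalIntegral.integral_add (i1.const_mul _)
    (i2.const_mul _), intervalIntegral.integral_const_mul, intervalIntegral.integral_const_mul,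
    integral_rpow_inner b1 hk, integral_rpow_inner b2 hk]
  have e1 : k ^ (-a - 1) = k ^ η * k ^ (-(a + η) - 1) := by
    rw [← Real.rpow_add hk0]; ring_nf
  have e2 : k ^ (-a - 1) = k ^ (-η) * k ^ (-(a - η) - 1) := by
    rw [← Real.rpow_add hk0]; ring_nf
  refine le_of_eq ?_
  calc _ = C * (1 / (a + η + 1) * (k ^ η * k ^ (-(a + η) - 1))
        + 1 / (a - η + 1) * (k ^ (-η) * k ^ (-(a - η) - 1))) := by ring
    _ = _ := by rw [← e1, ← e2]; ring

/-! ### Oscillatory integrals of the model singularity over `(0, π)` -/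

lemma one_div_le_pi_div_two {k : ℝ} (hk : 1 ≤ k) : 1 / k ≤ Real.pi / 2 := by
  have : 1 / k ≤ 1 := by rw [div_le_one (by linarith)]; exact hk
  linarith [Real.pi_gt_three]

lemma sin_pos_of_mem_uIcc {x y φ : ℝ} (hx : 0 < x) (hx' : x < Real.pi) (hy : 0 < y)
    (hy' : y < Real.pi) (hφ : φ ∈ Set.uIcc x y) : 0 < Real.sin φ := by
  refine Real.sin_pos_of_pos_of_lt_pi (lt_of_lt_of_le (lt_min hx hy) hφ.1)
    (lt_of_le_of_lt hφ.2 (max_lt hx' hy'))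

lemma intervalIntegrable_singTerm_mul (a : ℝ) (j : ℕ) {k : ℝ} (hk : 0 < k) {G w : ℝ → ℝ}
    (hG : Continuous G) (hw : Continuous w) {x y : ℝ} (hx : 0 < x) (hx' : x < Real.pi)
    (hy : 0 < y) (hy' : y < Real.pi) :
    IntervalIntegrable (fun φ => singTerm a j k G φ * w φ) MeasureTheory.volume x y :=
  ((continuousOn_singTerm a j hk hG fun _ h => sin_pos_of_mem_uIcc hx hx' hy hy' h).mul
    hw.continuousOn).intervalIntegrable

lemma integral_singTerm_reflect (a : ℝ) (j : ℕ) (k : ℝ) (G w : ℝ → ℝ) (x y : ℝ) :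
    ∫ φ in x..y, singTerm a j k G φ * w φ =
      ∫ φ in (Real.pi - y)..(Real.pi - x),
        singTerm a j k (fun φ => G (Real.pi - φ)) φ * w (Real.pi - φ) := by
  rw [← intervalIntegral.integral_comp_sub_left
    (fun φ => singTerm a j k (fun φ => G (Real.pi - φ)) φ * w (Real.pi - φ))]
  simp [singTerm_comp_pi_sub]

lemma singTerm_outer {a : ℝ} (ha : a < -1) (j : ℕ) {G : ℝ → ℝ} (hG : Continuous G) :
    ∃ C, ∀ k : ℝ, 1 ≤ k → ∀ w : ℝ → ℝ, Continuous w → (∀ x, |w x| ≤ 1) →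
      |∫ φ in (1 / k)..(Real.pi - 1 / k), singTerm a j k G φ * w φ| ≤ C * k ^ (-a - 1) := by
  obtain ⟨C, hC⟩ := singTerm_outer_half ha j hG
  obtain ⟨D, hD⟩ := singTerm_outer_half ha j (G := fun φ => G (Real.pi - φ)) (by fun_prop)
  refine ⟨C + D, fun k hk w hwc hw => ?_⟩
  have hk0 : 0 < k := by linarith
  have hik0 : 0 < 1 / k := by positivity
  have hik := one_div_le_pi_div_two hk
  have hp := Real.pi_pos
  rw [← intervalIntegral.integral_add_adjacent_intervals (b := Real.pi / 2)
    (intervalIntegrable_singTerm_mul a j hk0 hG hwc hik0 (by linarith) (by linarith) (by linarith))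
    (intervalIntegrable_singTerm_mul a j hk0 hG hwc (by linarith) (by linarith) (by linarith)
      (by linarith)),
    integral_singTerm_reflect a j k G w (Real.pi / 2), add_mul, sub_sub_cancel,
    sub_half]
  exact (abs_add_le _ _).trans (add_le_add (hC k hk w hw) (hD k hk _ fun x => hw _))

/-- Controls the boundary terms of the integration by parts. Since `k sin(1/k)` lies between `2/π`
and `1`, the logarithm there is bounded; taking `η = 1` in `abs_singTerm_le` makes both of its terms
equal to `k^(-a)`. -/
lemma abs_singTerm_one_div_le (a : ℝ) (j : ℕ) {G : ℝ → ℝ} (hG : Continuous G) :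
    ∃ C, ∀ k : ℝ, 1 ≤ k → |singTerm a j k G (1 / k)| ≤ C * k ^ (-a) := by
  obtain ⟨C, -, hC⟩ := abs_singTerm_le a j hG one_pos
  refine ⟨C * 2, fun k hk => ?_⟩
  have hk0 : 0 < k := by linarith
  have h := hC k hk0 (1 / k) (by positivity) (one_div_le_pi_div_two hk)
  refine h.trans (le_of_eq ?_)
  rw [one_div, Real.inv_rpow hk0.le, Real.inv_rpow hk0.le, ← Real.rpow_neg hk0.le,
    ← Real.rpow_neg hk0.le, ← Real.rpow_add hk0, ← Real.rpow_add hk0]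
  ring_nf

/-- Oscillatory bound away from the endpoints: integrating by parts lowers the exponent until the
absolute bound applies. -/
lemma singTerm_outer_osc (N : ℕ) : ∀ (a : ℝ) (_ : a < N - 1) (j : ℕ) (G : ℝ → ℝ)
    (_ : ContDiff ℝ (⊤ : ℕ∞) G), ∃ C, ∀ k : ℝ, 1 ≤ k → ∀ c : ℝ,
      |∫ φ in (1 / k)..(Real.pi - 1 / k), singTerm a j k G φ * Real.cos (2 * k * φ + c)|
        ≤ C * k ^ (-a - 1) := by
  induction N with
  | zero =>
    intro a ha j G hG
    obtain ⟨C, hC⟩ := singTerm_outer (a := a) (by simpa using ha) j hG.continuous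
    exact ⟨C, fun k hk c => hC k hk _ (by fun_prop) fun x => Real.abs_cos_le_one _⟩
  | succ N ih =>
    intro a ha j G hG
    have ha' : a - 1 < (N : ℝ) - 1 := by push_cast at ha; linarith
    have hG' : ContDiff ℝ (⊤ : ℕ∞) (deriv G) := ((contDiff_infty_iff_deriv).1 hG).2
    have hGd : Differentiable ℝ G := ((contDiff_infty_iff_deriv).1 hG).1
    have s1 : ContDiff ℝ (⊤ : ℕ∞) (fun x => a * Real.cos x * G x) :=
      (contDiff_const.mul Real.contDiff_cos).mul hG
    have s2 : ContDiff ℝ (⊤ : ℕ∞) (fun x => j * Real.cos x * G x) :=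
      (contDiff_const.mul Real.contDiff_cos).mul hG
    have s3 : ContDiff ℝ (⊤ : ℕ∞) (fun x => Real.sin x * deriv G x) := Real.contDiff_sin.mul hG'
    obtain ⟨C1, hC1⟩ := ih (a - 1) ha' j _ s1
    obtain ⟨C2, hC2⟩ := ih (a - 1) ha' (j - 1) _ s2
    obtain ⟨C3, hC3⟩ := ih (a - 1) ha' j _ s3
    obtain ⟨D, hD⟩ := abs_singTerm_one_div_le a j hG.continuous
    obtain ⟨E, hE⟩ := abs_singTerm_one_div_le a j (G := fun φ => G (Real.pi - φ))
      (hG.continuous.comp (by fun_prop))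
    refine ⟨(E + D + (C1 + C2 + C3)) / 2, fun k hk c => ?_⟩
    have hk0 : 0 < k := by linarith
    have hik0 : 0 < 1 / k := by positivity
    have hik := one_div_le_pi_div_two hk
    have hp := Real.pi_pos
    have l1 : 1 / k < Real.pi := by linarith
    have l2 : 0 < Real.pi - 1 / k := by linarith
    have l3 : Real.pi - 1 / k < Real.pi := by linarith
    have hsin : ∀ φ ∈ Set.uIcc (1 / k) (Real.pi - 1 / k), 0 < Real.sin φ := fun φ hφ =>
      sin_pos_of_mem_uIcc hik0 l1 l2 l3 hφ
    set T1 := singTerm (a - 1) j k (fun x => a * Real.cos x * G x) with hT1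
    set T2 := singTerm (a - 1) (j - 1) k (fun x => j * Real.cos x * G x) with hT2
    set T3 := singTerm (a - 1) j k (fun x => Real.sin x * deriv G x) with hT3
    -- The antiderivative `sin` is written as a cosine with shifted phase, so the induction
    -- hypothesis, stated for every phase `c`, applies to it.
    set w : ℝ → ℝ := fun φ => Real.cos (2 * k * φ + (c - Real.pi / 2)) with hw
    have hwc : Continuous w := by rw [hw]; fun_prop
    have hv : ∀ φ, HasDerivAt (fun x => w x / (2 * k)) (Real.cos (2 * k * φ + c)) φ := by
      intro φ
      have h1 : HasDerivAt (fun x : ℝ => 2 * k * x + (c - Real.pi / 2)) (2 * k) φ := by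
        simpa using ((hasDerivAt_id φ).const_mul (2 * k)).add_const (c - Real.pi / 2)
      refine (h1.cos.div_const (2 * k)).congr_deriv ?_
      rw [← add_sub_assoc, Real.sin_sub_pi_div_two]
      field_simp
    have i1 := intervalIntegrable_singTerm_mul (a - 1) j hk0 s1.continuous hwc hik0 l1 l2 l3
    have i2 := intervalIntegrable_singTerm_mul (a - 1) (j - 1) hk0 s2.continuous hwc hik0 l1 l2 l3
    have i3 := intervalIntegrable_singTerm_mul (a - 1) j hk0 s3.continuous hwc hik0 l1 l2 l3
    have c1 := continuousOn_singTerm (a - 1) j hk0 s1.continuous hsin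
    have c2 := continuousOn_singTerm (a - 1) (j - 1) hk0 s2.continuous hsin
    have c3 := continuousOn_singTerm (a - 1) j hk0 s3.continuous hsin
    have ibp := intervalIntegral.integral_mul_deriv_eq_deriv_mul
      (a := 1 / k) (b := Real.pi - 1 / k) (u := singTerm a j k G)
      (u' := fun φ => T1 φ + T2 φ + T3 φ) (v := fun x => w x / (2 * k))
      (v' := fun φ => Real.cos (2 * k * φ + c))
      (fun φ hφ => hasDerivAt_singTerm a j hk0 hGd (hsin φ hφ)) (fun φ _ => hv φ)
      ((c1.add c2).add c3).intervalIntegrable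
      (Continuous.intervalIntegrable (by fun_prop) _ _)
    have hsplit : ∫ φ in (1 / k)..(Real.pi - 1 / k), (T1 φ + T2 φ + T3 φ) * (w φ / (2 * k))
        = ((∫ φ in (1 / k)..(Real.pi - 1 / k), T1 φ * w φ)
          + (∫ φ in (1 / k)..(Real.pi - 1 / k), T2 φ * w φ)
          + (∫ φ in (1 / k)..(Real.pi - 1 / k), T3 φ * w φ)) / (2 * k) := by
      rw [← intervalIntegral.integral_add i1 i2, ← intervalIntegral.integral_add (i1.add i2) i3,
        ← intervalIntegral.integral_div]
      congr 1
      ext φ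
      ring
    have b1 := hC1 k hk (c - Real.pi / 2)
    have b2 := hC2 k hk (c - Real.pi / 2)
    have b3 := hC3 k hk (c - Real.pi / 2)
    have hexp : -(a - 1) - 1 = -a := by ring
    rw [hexp] at b1 b2 b3
    have hwle : ∀ x, |w x| ≤ 1 := fun x => Real.abs_cos_le_one _
    have d1 : |singTerm a j k G (1 / k) * w (1 / k)| ≤ D * k ^ (-a) := by
      rw [abs_mul]
      exact (mul_le_of_le_one_right (abs_nonneg _) (hwle _)).trans (hD k hk)
    have d2 : |singTerm a j k G (Real.pi - 1 / k) * w (Real.pi - 1 / k)| ≤ E * k ^ (-a) := by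
      rw [abs_mul, singTerm_comp_pi_sub]
      exact (mul_le_of_le_one_right (abs_nonneg _) (hwle _)).trans (hE k hk)
    rw [ibp, hsplit]
    set I1 := ∫ φ in (1 / k)..(Real.pi - 1 / k), T1 φ * w φ
    set I2 := ∫ φ in (1 / k)..(Real.pi - 1 / k), T2 φ * w φ
    set I3 := ∫ φ in (1 / k)..(Real.pi - 1 / k), T3 φ * w φ
    set X := singTerm a j k G (Real.pi - 1 / k) * w (Real.pi - 1 / k)
    set Y := singTerm a j k G (1 / k) * w (1 / k)
    have hre : singTerm a j k G (Real.pi - 1 / k) * (w (Real.pi - 1 / k) / (2 * k))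
        - singTerm a j k G (1 / k) * (w (1 / k) / (2 * k)) - (I1 + I2 + I3) / (2 * k)
        = (X - Y - (I1 + I2 + I3)) / (2 * k) := by
      simp only [X, Y]; ring
    -- Boundary terms and remaining integrals are all `O(k^(-a))`; the `1/(2k)` from the
    -- antiderivative supplies the last power.
    have hk2 : k ^ (-a - 1) = k ^ (-a) / k := Real.rpow_sub_one hk0.ne' _
    rw [hre, abs_div, abs_of_pos (by positivity : 0 < 2 * k), hk2, div_mul_div_comm]
    gcongr
    have e1 := abs_le.1 b1
    have e2 := abs_le.1 b2
    have e3 := abs_le.1 b3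
    have e4 := abs_le.1 d1
    have e5 := abs_le.1 d2
    rw [abs_le]
    constructor <;> linarith [e1.1, e1.2, e2.1, e2.2, e3.1, e3.2, e4.1, e4.2, e5.1, e5.2]

lemma intervalIntegrable_singTerm {a : ℝ} (ha : -1 < a) (j : ℕ) {G : ℝ → ℝ}
    (hG : Continuous G) {k : ℝ} (hk : 0 < k) :
    IntervalIntegrable (singTerm a j k G) MeasureTheory.volume 0 Real.pi := by
  have h1 := singTerm_intervalIntegrable_half ha j hG hk
  have h2 := (singTerm_intervalIntegrable_half ha j (G := fun φ => G (Real.pi - φ))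
    (by fun_prop) hk).comp_sub_left Real.pi
  simp only [singTerm_comp_pi_sub, sub_sub_cancel, sub_zero, sub_half] at h2
  exact h1.trans h2.symm

/-- Fourier coefficients of the model singularity at scale `k` carry no logarithm. -/
lemma singTerm_osc {a : ℝ} (ha : -1 < a) (j : ℕ) {G : ℝ → ℝ} (hG : ContDiff ℝ (⊤ : ℕ∞) G) :
    ∃ C, ∀ k : ℝ, 1 ≤ k →
      |∫ φ in (0 : ℝ)..Real.pi, singTerm a j k G φ * Real.cos (2 * k * φ)|
        ≤ C * k ^ (-a - 1) := by
  -- `N` integrations by parts bring the exponent to `a - N < -1`.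
  obtain ⟨N, hN⟩ := exists_nat_gt (a + 1)
  obtain ⟨C, hC⟩ := singTerm_outer_osc N a (by linarith) j G hG
  obtain ⟨D, hD⟩ := singTerm_inner_half ha j hG.continuous
  obtain ⟨E, hE⟩ := singTerm_inner_half ha j (G := fun φ => G (Real.pi - φ))
    (hG.continuous.comp (by fun_prop))
  refine ⟨D + C + E, fun k hk => ?_⟩
  have hk0 : 0 < k := by linarith
  have hik0 : 0 < 1 / k := by positivity
  have hik := one_div_le_pi_div_two hk
  have hp := Real.pi_pos
  have hint := (intervalIntegrable_singTerm ha j hG.continuous hk0).mul_continuousOn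
    (g := fun φ => Real.cos (2 * k * φ)) (by fun_prop)
  have m1 : 1 / k ∈ Set.uIcc 0 Real.pi := by
    rw [Set.uIcc_of_le hp.le]; constructor <;> linarith
  have m2 : Real.pi - 1 / k ∈ Set.uIcc 0 Real.pi := by
    rw [Set.uIcc_of_le hp.le]; constructor <;> linarith
  have i1 := hint.mono_set (Set.uIcc_subset_uIcc Set.left_mem_uIcc m1)
  have i2 := hint.mono_set (Set.uIcc_subset_uIcc m1 m2)
  have i3 := hint.mono_set (Set.uIcc_subset_uIcc m2 Set.right_mem_uIcc)
  rw [← intervalIntegral.integral_add_adjacent_intervals (i1.trans i2) i3,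
    ← intervalIntegral.integral_add_adjacent_intervals i1 i2,
    integral_singTerm_reflect a j k G _ (Real.pi - 1 / k), sub_self, sub_sub_cancel,
    add_mul, add_mul]
  have h2 := hC k hk 0
  simp only [add_zero] at h2
  exact (abs_add_three _ _ _).trans (add_le_add (add_le_add
    (hD k hk _ fun x => Real.abs_cos_le_one _) h2) (hE k hk _ fun x => Real.abs_cos_le_one _))

/-! ### Smooth periodic integrands -/

/-- Rapid decay of the Fourier coefficients of a smooth `π`-periodic function. -/
lemma periodic_osc (N : ℕ) : ∀ (H : ℝ → ℝ) (_ : ContDiff ℝ (⊤ : ℕ∞) H)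
    (_ : Function.Periodic H Real.pi), ∃ C, ∀ k : ℕ, 1 ≤ k → ∀ c : ℝ,
      |∫ φ in (0 : ℝ)..Real.pi, H φ * Real.cos (2 * k * φ + c)| ≤ C / (k : ℝ) ^ N := by
  induction N with
  | zero =>
    intro H hH _
    obtain ⟨M, hM⟩ := (isCompact_uIcc (a := (0 : ℝ)) (b := Real.pi)).exists_bound_of_continuousOn
      hH.continuous.continuousOn
    refine ⟨M * |Real.pi - 0|, fun k _ c => ?_⟩
    rw [pow_zero, div_one]
    refine intervalIntegral.norm_integral_le_of_norm_le_const (a := 0) (b := Real.pi)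
      (f := fun φ => H φ * Real.cos (2 * k * φ + c)) fun φ hφ => ?_
    rw [norm_mul]
    exact (mul_le_of_le_one_right (norm_nonneg _) (Real.abs_cos_le_one _)).trans
      (hM φ (Set.uIoc_subset_uIcc hφ))
  | succ N ih =>
    intro H hH hper
    have hH' : ContDiff ℝ (⊤ : ℕ∞) (deriv H) := ((contDiff_infty_iff_deriv).1 hH).2
    have hHd : Differentiable ℝ H := ((contDiff_infty_iff_deriv).1 hH).1
    have hper' : Function.Periodic (deriv H) Real.pi := by
      intro x
      rw [← deriv_comp_add_const]
      congr 1
      ext y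
      exact hper y
    obtain ⟨C, hC⟩ := ih _ hH' hper'
    refine ⟨C / 2, fun k hk c => ?_⟩
    have hk0 : (0 : ℝ) < k := by exact_mod_cast hk
    set w : ℝ → ℝ := fun φ => Real.cos (2 * k * φ + (c - Real.pi / 2)) with hw
    have hv : ∀ φ, HasDerivAt (fun x => w x / (2 * k)) (Real.cos (2 * k * φ + c)) φ := by
      intro φ
      have h1 : HasDerivAt (fun x : ℝ => 2 * k * x + (c - Real.pi / 2)) (2 * k) φ := by
        simpa using ((hasDerivAt_id φ).const_mul (2 * (k : ℝ))).add_const (c - Real.pi / 2)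
      refine (h1.cos.div_const (2 * (k : ℝ))).congr_deriv ?_
      rw [← add_sub_assoc, Real.sin_sub_pi_div_two]
      field_simp
    have ibp := intervalIntegral.integral_mul_deriv_eq_deriv_mul
      (a := 0) (b := Real.pi) (u := H) (u' := deriv H) (v := fun x => w x / (2 * k))
      (v' := fun φ => Real.cos (2 * k * φ + c))
      (fun φ _ => (hHd φ).hasDerivAt) (fun φ _ => hv φ)
      (hH'.continuous.intervalIntegrable _ _)
      (Continuous.intervalIntegrable (by fun_prop) _ _)
    -- The boundary terms cancel: `H` has period `π`, and so does `w` because `k` is an integer.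
    have hH0 : H Real.pi = H 0 := by simpa using hper 0
    have hw0 : w Real.pi = w 0 := by
      simp only [hw]
      rw [mul_zero, zero_add, show 2 * (k : ℝ) * Real.pi + (c - Real.pi / 2)
        = (c - Real.pi / 2) + k * (2 * Real.pi) by ring, Real.cos_add_nat_mul_two_pi]
    rw [ibp, hH0, hw0, sub_self, zero_sub, abs_neg]
    simp only [← mul_div_assoc]
    rw [intervalIntegral.integral_div, abs_div, abs_of_pos (by positivity : 0 < 2 * (k : ℝ)),
      div_div, pow_succ]
    calc _ ≤ C / (k : ℝ) ^ N / (2 * k) := by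
          gcongr
          exact hC k hk (c - Real.pi / 2)
      _ = _ := by rw [div_div]; ring

/-! ### From Chebyshev integrals to Fourier integrals -/

/-- The singular function `(1-x)^γ ln^μ(1-x) g(x)`. -/
noncomputable def logSingRight (γ : ℝ) (μ : ℕ) (g : ℝ → ℝ) (x : ℝ) : ℝ :=
  (1 - x) ^ γ * Real.log (1 - x) ^ μ * g x

lemma integral_chebyshevIntegrand (f : ℝ → ℝ) (k : ℕ) :
    ∫ x in (-1 : ℝ)..1, chebyshevIntegrand f k x =
      ∫ θ in (0 : ℝ)..Real.pi, f (Real.cos θ) * Real.cos (k * θ) := by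
  have h := Polynomial.Chebyshev.integral_measureT_eq_integral_cos
    (f := fun x => f x * (Polynomial.Chebyshev.T ℝ (k : ℤ)).eval x)
  rw [Polynomial.Chebyshev.integral_measureT] at h
  simpa [chebyshevIntegrand, Real.sqrt_inv] using h

/-- Under `x = cos θ` the Jacobian `sin θ` cancels the weight `1/√(1 - x²)`. -/
lemma intervalIntegrable_chebyshevIntegrand {f : ℝ → ℝ}
    (hf : IntervalIntegrable (fun θ => f (Real.cos θ)) MeasureTheory.volume 0 Real.pi) (k : ℕ) :
    IntervalIntegrable (chebyshevIntegrand f k) MeasureTheory.volume (-1) 1 := by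
  have himg : Real.cos '' Set.Ioo 0 Real.pi = Set.Ioo (-1) 1 := by
    ext x
    constructor
    · rintro ⟨θ, hθ, rfl⟩
      constructor
      · rw [← Real.cos_pi]
        exact Real.cos_lt_cos_of_nonneg_of_le_pi hθ.1.le le_rfl hθ.2
      · rw [← Real.cos_zero]
        exact Real.cos_lt_cos_of_nonneg_of_le_pi le_rfl hθ.2.le hθ.1
    · intro hx
      exact ⟨Real.arccos x, ⟨Real.arccos_pos.2 hx.2, Real.arccos_lt_pi.2 hx.1⟩,
        Real.cos_arccos hx.1.le hx.2.le⟩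
  have hf' := hf.mul_continuousOn (g := fun θ => Real.cos (k * θ)) (by fun_prop)
  rw [intervalIntegrable_iff_integrableOn_Ioo_of_le (by norm_num), ← himg,
    MeasureTheory.integrableOn_image_iff_integrableOn_abs_deriv_smul measurableSet_Ioo
      (fun x _ => (Real.hasDerivAt_cos x).hasDerivWithinAt)
      (Real.injOn_cos.mono Set.Ioo_subset_Icc_self)]
  rw [intervalIntegrable_iff_integrableOn_Ioo_of_le Real.pi_pos.le] at hf'
  refine hf'.congr_fun (fun θ hθ => ?_) measurableSet_Ioo
  have hs : 0 < Real.sin θ := Real.sin_pos_of_pos_of_lt_pi hθ.1 hθ.2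
  have h2 : Real.sqrt (1 - Real.cos θ ^ 2) = Real.sin θ := by
    rw [← Real.sin_sq, Real.sqrt_sq hs.le]
  simp only [chebyshevIntegrand, h2, Polynomial.Chebyshev.T_real_cos, abs_neg, abs_of_pos hs,
    smul_eq_mul, Int.cast_natCast]
  field_simp

lemma intervalIntegrable_comp_cos_iff {f : ℝ → ℝ} :
    IntervalIntegrable (fun φ => f (Real.cos (2 * φ))) MeasureTheory.volume 0 (Real.pi / 2) ↔
      IntervalIntegrable (fun θ => f (Real.cos θ)) MeasureTheory.volume 0 Real.pi := by
  have := IntervalIntegrable.comp_mul_left_iff (f := fun θ => f (Real.cos θ)) (a := 0)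
    (b := Real.pi) (two_ne_zero (α := ℝ)) enorm_ne_top
  simpa using this

/-- With `θ = 2φ` the integral is twice the one over `(0, π/2)`, and symmetry about `π/2` spreads it
over `(0, π)`. Both ends then correspond to `x = 1`, while `x = -1` becomes the interior point
`π/2`. -/
lemma integral_chebyshevIntegrand_eq_double (f : ℝ → ℝ) (k : ℕ)
    (hf : IntervalIntegrable (fun φ => f (Real.cos (2 * φ))) MeasureTheory.volume 0 Real.pi) :
    ∫ x in (-1 : ℝ)..1, chebyshevIntegrand f k x =
      ∫ φ in (0 : ℝ)..Real.pi, f (Real.cos (2 * φ)) * Real.cos (2 * k * φ) := by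
  have hp := Real.pi_pos
  have hint := hf.mul_continuousOn (g := fun φ => Real.cos (2 * k * φ)) (by fun_prop)
  have m1 : Real.pi / 2 ∈ Set.uIcc 0 Real.pi := by
    rw [Set.uIcc_of_le hp.le]; constructor <;> linarith
  have i1 := hint.mono_set (Set.uIcc_subset_uIcc Set.left_mem_uIcc m1)
  have i2 := hint.mono_set (Set.uIcc_subset_uIcc m1 Set.right_mem_uIcc)
  have hsym : ∫ φ in (Real.pi / 2)..Real.pi, f (Real.cos (2 * φ)) * Real.cos (2 * k * φ)
      = ∫ φ in (0 : ℝ)..(Real.pi / 2), f (Real.cos (2 * φ)) * Real.cos (2 * k * φ) := by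
    have h := intervalIntegral.integral_comp_sub_left (a := 0) (b := Real.pi / 2)
      (fun φ => f (Real.cos (2 * φ)) * Real.cos (2 * k * φ)) Real.pi
    rw [sub_half, sub_zero] at h
    rw [← h]
    congr 1
    ext φ
    rw [show 2 * (Real.pi - φ) = 2 * Real.pi - 2 * φ by ring, Real.cos_two_pi_sub,
      show 2 * (k : ℝ) * (Real.pi - φ) = k * (2 * Real.pi) - 2 * k * φ by ring,
      Real.cos_nat_mul_two_pi_sub]
  rw [← intervalIntegral.integral_add_adjacent_intervals i1 i2, hsym, integral_chebyshevIntegrand]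
  have h := intervalIntegral.integral_comp_mul_left (a := 0) (b := Real.pi / 2)
    (fun θ => f (Real.cos θ) * Real.cos (k * θ)) (two_ne_zero (α := ℝ))
  have e : ∀ φ : ℝ, Real.cos (k * (2 * φ)) = Real.cos (2 * k * φ) := fun φ => by ring_nf
  simp only [e, mul_zero, smul_eq_mul, mul_div_cancel₀ Real.pi (two_ne_zero (α := ℝ))] at h
  rw [h]
  ring

lemma logSingRight_cos_two_mul (γ : ℝ) (μ : ℕ) (g : ℝ → ℝ) {φ : ℝ} (hφ : 0 < Real.sin φ) :
    logSingRight γ μ g (Real.cos (2 * φ)) =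
      singTerm (2 * γ) μ (Real.sqrt 2) (fun x => 2 ^ γ * 2 ^ μ * g (Real.cos (2 * x))) φ := by
  have h1 : 1 - Real.cos (2 * φ) = 2 * Real.sin φ ^ 2 := by
    rw [Real.cos_two_mul, Real.cos_sq']; ring
  have h2 : 2 * Real.sin φ ^ 2 = (Real.sqrt 2 * Real.sin φ) ^ 2 := by
    rw [mul_pow, Real.sq_sqrt (by norm_num)]
  have h3 : (2 * Real.sin φ ^ 2) ^ γ = 2 ^ γ * Real.sin φ ^ (2 * γ) := by
    rw [Real.mul_rpow (by norm_num) (by positivity), Real.rpow_mul hφ.le, Real.rpow_two]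
  rw [logSingRight, singTerm, h1, h3, h2, Real.log_pow, mul_pow]
  push_cast
  ring

/-- Regularity of `g` on the closed interval suffices, because the cosine never leaves it. -/
lemma contDiff_comp_cos_two_mul {g : ℝ → ℝ} (hg : AnalyticOn ℝ g (Set.Icc (-1) 1)) (A : ℝ) :
    ContDiff ℝ (⊤ : ℕ∞) (fun x => A * g (Real.cos (2 * x))) := by
  refine contDiff_const.mul ?_
  exact (hg.contDiffOn_of_completeSpace (n := ((⊤ : ℕ∞) : WithTop ℕ∞))).comp_contDiff
    (Real.contDiff_cos.comp (contDiff_const.mul contDiff_id)) fun x => Real.cos_mem_Icc _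

lemma intervalIntegrable_logSingRight_double {γ : ℝ} (hγ : -(1 / 2 : ℝ) < γ) (μ : ℕ) {g : ℝ → ℝ}
    (hg : AnalyticOn ℝ g (Set.Icc (-1) 1)) :
    IntervalIntegrable (fun φ => logSingRight γ μ g (Real.cos (2 * φ)))
      MeasureTheory.volume 0 Real.pi := by
  have h := intervalIntegrable_singTerm (a := 2 * γ) (by linarith) μ
    (contDiff_comp_cos_two_mul hg (2 ^ γ * 2 ^ μ)).continuous
    (k := Real.sqrt 2) (by positivity)
  rw [intervalIntegrable_iff_integrableOn_Ioo_of_le Real.pi_pos.le] at h ⊢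
  exact h.congr_fun (fun φ hφ => (logSingRight_cos_two_mul γ μ g
    (Real.sin_pos_of_pos_of_lt_pi hφ.1 hφ.2)).symm) measurableSet_Ioo

lemma intervalIntegrable_chebyshevIntegrand_logSingRight {γ : ℝ} (hγ : -(1 / 2 : ℝ) < γ) (μ : ℕ)
    {g : ℝ → ℝ} (hg : AnalyticOn ℝ g (Set.Icc (-1) 1)) (k : ℕ) :
    IntervalIntegrable (chebyshevIntegrand (logSingRight γ μ g) k)
      MeasureTheory.volume (-1) 1 := by
  have hp := Real.pi_pos
  refine intervalIntegrable_chebyshevIntegrand (intervalIntegrable_comp_cos_iff.1 ?_) k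
  refine (intervalIntegrable_logSingRight_double hγ μ hg).mono_set
    (Set.uIcc_subset_uIcc Set.left_mem_uIcc ?_)
  rw [Set.uIcc_of_le hp.le]
  constructor <;> linarith

/-- Binomial expansion of `log(κ sin φ) = log(k sin φ) - log(k/κ)`: all growth in `log k` is moved
into constants outside the integral. -/
lemma singTerm_rescale (a : ℝ) (μ : ℕ) {κ k : ℝ} (hκ : 0 < κ) (hk : 0 < k) (G : ℝ → ℝ) {φ : ℝ}
    (hφ : 0 < Real.sin φ) :
    singTerm a μ κ G φ = ∑ j ∈ Finset.range (μ + 1),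
      ((-Real.log (k / κ)) ^ (μ - j) * μ.choose j) * singTerm a j k G φ := by
  have h : Real.log (κ * Real.sin φ) = Real.log (k * Real.sin φ) + -Real.log (k / κ) := by
    rw [Real.log_mul hκ.ne' hφ.ne', Real.log_mul hk.ne' hφ.ne', Real.log_div hk.ne' hκ.ne']
    ring
  rw [singTerm, h, add_pow, Finset.mul_sum, Finset.sum_mul]
  refine Finset.sum_congr rfl fun j _ => ?_
  rw [singTerm]
  ring

/-- Expansion of the Chebyshev integral in powers of `log k`. -/
lemma integral_chebyshevIntegrand_logSingRight {γ : ℝ} (hγ : -(1 / 2 : ℝ) < γ) (μ : ℕ)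
    {g : ℝ → ℝ} (hg : AnalyticOn ℝ g (Set.Icc (-1) 1)) {k : ℕ} (hk : 0 < k) :
    ∫ x in (-1 : ℝ)..1, chebyshevIntegrand (logSingRight γ μ g) k x =
      ∑ j ∈ Finset.range (μ + 1), ((-Real.log (k / Real.sqrt 2)) ^ (μ - j) * μ.choose j) *
        ∫ φ in (0 : ℝ)..Real.pi,
          singTerm (2 * γ) j k (fun x => 2 ^ γ * 2 ^ μ * g (Real.cos (2 * x))) φ
            * Real.cos (2 * k * φ) := by
  have hk0 : (0 : ℝ) < k := by exact_mod_cast hk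
  rw [integral_chebyshevIntegrand_eq_double _ _ (intervalIntegrable_logSingRight_double hγ μ hg)]
  simp_rw [← intervalIntegral.integral_const_mul]
  rw [← intervalIntegral.integral_finsetSum]
  · rw [intervalIntegral.integral_of_le Real.pi_pos.le,
      intervalIntegral.integral_of_le Real.pi_pos.le,
      MeasureTheory.integral_Ioc_eq_integral_Ioo, MeasureTheory.integral_Ioc_eq_integral_Ioo]
    refine MeasureTheory.setIntegral_congr_fun measurableSet_Ioo fun φ hφ => ?_
    have hs := Real.sin_pos_of_pos_of_lt_pi hφ.1 hφ.2
    rw [logSingRight_cos_two_mul γ μ g hs,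
      singTerm_rescale (2 * γ) μ (κ := Real.sqrt 2) (k := k) (by positivity) hk0 _ hs,
      Finset.sum_mul]
    exact Finset.sum_congr rfl fun j _ => by ring
  · intro j _
    exact ((intervalIntegrable_singTerm (by linarith) j
      (contDiff_comp_cos_two_mul hg (2 ^ γ * 2 ^ μ)).continuous hk0).mul_continuousOn
      (by fun_prop)).const_mul _

/-! ### Asymptotics for the singularity at `x = 1` -/

lemma isBigO_singTerm_osc {a : ℝ} (ha : -1 < a) (j : ℕ) {G : ℝ → ℝ}
    (hG : ContDiff ℝ (⊤ : ℕ∞) G) :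
    (fun k : ℕ => ∫ φ in (0 : ℝ)..Real.pi, singTerm a j k G φ * Real.cos (2 * k * φ))
      =O[atTop] fun k : ℕ => ((k : ℝ) ^ (a + 1))⁻¹ := by
  obtain ⟨C, hC⟩ := singTerm_osc ha j hG
  refine IsBigO.of_bound C ?_
  filter_upwards [eventually_ge_atTop 1] with k hk
  have hk1 : (1 : ℝ) ≤ k := by exact_mod_cast hk
  have hk0 : (0 : ℝ) ≤ k := by linarith
  rw [← Real.rpow_neg hk0, neg_add', Real.norm_eq_abs, Real.norm_of_nonneg (by positivity)]
  exact hC k hk1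

lemma isBigO_log_div_sqrt_two :
    (fun k : ℕ => -Real.log (k / Real.sqrt 2)) =O[atTop] fun k : ℕ => Real.log k := by
  refine IsBigO.of_bound 1 ?_
  filter_upwards [eventually_ge_atTop 2] with k hk
  have hk2 : (2 : ℝ) ≤ k := by exact_mod_cast hk
  have h1 : 1 ≤ Real.sqrt 2 := by rw [Real.one_le_sqrt]; norm_num
  have h2 : Real.sqrt 2 ≤ 2 := by rw [Real.sqrt_le_left (by norm_num)]; norm_num
  have h0 : 0 ≤ Real.log (k / Real.sqrt 2) := Real.log_nonneg (by
    rw [le_div_iff₀ (by positivity)]; linarith)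
  rw [norm_neg, one_mul, Real.norm_of_nonneg h0, Real.norm_of_nonneg (Real.log_nonneg (by linarith))]
  exact Real.log_le_log (by positivity) (div_le_self (by linarith) h1)

lemma isBigO_log_pow_of_le {i n : ℕ} (h : i ≤ n) :
    (fun k : ℕ => Real.log k ^ i) =O[atTop] fun k : ℕ => Real.log k ^ n := by
  refine IsBigO.of_bound 1 ?_
  have ht := Real.tendsto_log_atTop.comp (tendsto_natCast_atTop_atTop (R := ℝ))
  filter_upwards [ht.eventually_ge_atTop 1] with k hk
  have hk' : (1 : ℝ) ≤ Real.log k := hk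
  rw [one_mul, norm_pow, norm_pow, Real.norm_of_nonneg (by linarith)]
  exact pow_le_pow_right₀ hk' h

lemma isBigO_logSingRight_term {γ : ℝ} (hγ : -(1 / 2 : ℝ) < γ) {μ j n : ℕ} (hjn : μ - j ≤ n)
    {G : ℝ → ℝ} (hG : ContDiff ℝ (⊤ : ℕ∞) G) :
    (fun k : ℕ => ((-Real.log (k / Real.sqrt 2)) ^ (μ - j) * μ.choose j) *
        ∫ φ in (0 : ℝ)..Real.pi, singTerm (2 * γ) j k G φ * Real.cos (2 * k * φ))
      =O[atTop] fun k : ℕ => Real.log k ^ n / (k : ℝ) ^ (2 * γ + 1) := by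
  simp only [div_eq_mul_inv (Real.log _ ^ n)]
  refine IsBigO.mul ?_ (isBigO_singTerm_osc (by linarith) j hG)
  have h := ((isBigO_log_div_sqrt_two.pow (μ - j)).trans
    (isBigO_log_pow_of_le hjn)).const_mul_left (μ.choose j : ℝ)
  simpa only [mul_comm (μ.choose j : ℝ)] using h

lemma isBigO_chebyshev_logSingRight {γ : ℝ} (hγ : -(1 / 2 : ℝ) < γ) (μ : ℕ)
    {g : ℝ → ℝ} (hg : AnalyticOn ℝ g (Set.Icc (-1) 1)) :
    (fun k : ℕ => ∫ x in (-1 : ℝ)..1, chebyshevIntegrand (logSingRight γ μ g) k x)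
      =O[atTop] fun k : ℕ => Real.log k ^ μ / (k : ℝ) ^ (2 * γ + 1) := by
  refine IsBigO.congr' (IsBigO.sum (s := Finset.range (μ + 1)) fun j _ =>
    isBigO_logSingRight_term hγ (Nat.sub_le μ j)
      (contDiff_comp_cos_two_mul hg (2 ^ γ * 2 ^ μ))) ?_ (EventuallyEq.refl _ _)
  filter_upwards [eventually_gt_atTop 0] with k hk
  rw [integral_chebyshevIntegrand_logSingRight hγ μ hg hk, Finset.sum_apply]

/-- The `j = 0` term for an integer exponent. No logarithm is left in the integrand, and the even
power `(sin φ)^(2m)` is smooth and `π`-periodic. -/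
lemma isBigO_logSingRight_smooth_term {m μ : ℕ} (hμ : 0 < μ) {G : ℝ → ℝ}
    (hG : ContDiff ℝ (⊤ : ℕ∞) G) (hper : Function.Periodic G Real.pi) :
    (fun k : ℕ => ((-Real.log (k / Real.sqrt 2)) ^ μ) *
        ∫ φ in (0 : ℝ)..Real.pi, singTerm (2 * (m : ℝ)) 0 k G φ * Real.cos (2 * k * φ))
      =O[atTop] fun k : ℕ => Real.log k ^ (μ - 1) / (k : ℝ) ^ (2 * (m : ℝ) + 1) := by
  have hH : ContDiff ℝ (⊤ : ℕ∞) (fun x => Real.sin x ^ (2 * m) * G x) :=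
    (Real.contDiff_sin.pow _).mul hG
  have hHper : Function.Periodic (fun x => Real.sin x ^ (2 * m) * G x) Real.pi := by
    intro x
    simp only [hper x, Real.sin_add_pi, (even_two_mul m).neg_pow]
  -- One order more than the target `2m + 1`; the spare `1/k` absorbs one factor `log k ≤ k`.
  obtain ⟨C, hC⟩ := periodic_osc (2 * m + 2) _ hH hHper
  have hI : (fun k : ℕ => ∫ φ in (0 : ℝ)..Real.pi,
      singTerm (2 * (m : ℝ)) 0 k G φ * Real.cos (2 * k * φ))
      =O[atTop] fun k : ℕ => ((k : ℝ) ^ (2 * m + 2))⁻¹ := by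
    refine IsBigO.of_bound C ?_
    filter_upwards [eventually_ge_atTop 1] with k hk
    have h := hC k hk 0
    rw [Real.norm_eq_abs, Real.norm_of_nonneg (by positivity), ← div_eq_mul_inv]
    have e : ∀ φ, singTerm (2 * (m : ℝ)) 0 k G φ = Real.sin φ ^ (2 * m) * G φ := fun φ => by
      rw [singTerm, pow_zero, mul_one, ← Real.rpow_natCast]; push_cast; rfl
    simpa only [e, add_zero] using h
  refine ((isBigO_log_div_sqrt_two.pow μ).mul hI).trans ?_
  refine IsBigO.of_bound 1 ?_
  filter_upwards [eventually_ge_atTop 1] with k hk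
  have hk1 : (1 : ℝ) ≤ k := by exact_mod_cast hk
  have hk0 : (0 : ℝ) < k := by linarith
  have hl : 0 ≤ Real.log k := Real.log_nonneg hk1
  have hlk : Real.log k ≤ k := (Real.log_le_sub_one_of_pos hk0).trans (by linarith)
  have hr : (k : ℝ) ^ (2 * (m : ℝ) + 1) = (k : ℝ) ^ (2 * m + 1) := by
    rw [← Real.rpow_natCast]; push_cast; rfl
  rw [one_mul, Real.norm_of_nonneg (by positivity), Real.norm_of_nonneg (by positivity), hr,
    ← div_eq_mul_inv, div_le_div_iff₀ (by positivity) (by positivity), pow_succ (k : ℝ) (2 * m + 1)]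
  obtain ⟨n, rfl⟩ : ∃ n, μ = n + 1 := ⟨μ - 1, by omega⟩
  rw [Nat.add_sub_cancel, pow_succ (Real.log k)]
  calc Real.log k ^ n * Real.log k * (k : ℝ) ^ (2 * m + 1)
      ≤ Real.log k ^ n * k * (k : ℝ) ^ (2 * m + 1) := by gcongr
    _ = _ := by ring

lemma isBigO_chebyshev_logSingRight_of_nat (m : ℕ) {μ : ℕ} (hμ : 0 < μ)
    {g : ℝ → ℝ} (hg : AnalyticOn ℝ g (Set.Icc (-1) 1)) :
    (fun k : ℕ => ∫ x in (-1 : ℝ)..1, chebyshevIntegrand (logSingRight m μ g) k x)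
      =O[atTop] fun k : ℕ => Real.log k ^ (μ - 1) / (k : ℝ) ^ (2 * (m : ℝ) + 1) := by
  have hm : -(1 / 2 : ℝ) < m := by
    have : (0 : ℝ) ≤ m := m.cast_nonneg
    linarith
  have hG := contDiff_comp_cos_two_mul hg (2 ^ (m : ℝ) * 2 ^ μ)
  have hper : Function.Periodic (fun x => 2 ^ (m : ℝ) * 2 ^ μ * g (Real.cos (2 * x)))
      Real.pi := by
    intro x
    simp only [mul_add, Real.cos_add_two_pi]
  -- The terms with index `j + 1` carry at most `log^(μ-1) k`; the `j = 0` term, split off, is the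
  -- smooth one.
  refine IsBigO.congr' ((IsBigO.sum (s := Finset.range μ) fun j _ =>
    isBigO_logSingRight_term (j := j + 1) (n := μ - 1) hm
      (show μ - (j + 1) ≤ μ - 1 by omega) hG).add
    (isBigO_logSingRight_smooth_term (m := m) hμ hG hper)) ?_ (EventuallyEq.refl _ _)
  filter_upwards [eventually_gt_atTop 0] with k hk
  rw [integral_chebyshevIntegrand_logSingRight hm μ hg hk, Finset.sum_range_succ', Nat.sub_zero,
    Nat.choose_zero_right, Nat.cast_one, mul_one, Finset.sum_apply]

lemma isBigO_chebyshev_logSingRight_of_isPosInteger {γ : ℝ} (hγ : IsPosInteger γ) {μ : ℕ}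
    (hμ : 0 < μ) {g : ℝ → ℝ} (hg : AnalyticOn ℝ g (Set.Icc (-1) 1)) :
    (fun k : ℕ => ∫ x in (-1 : ℝ)..1, chebyshevIntegrand (logSingRight γ μ g) k x)
      =O[atTop] fun k : ℕ => Real.log k ^ (μ - 1) / (k : ℝ) ^ (2 * γ + 1) := by
  obtain ⟨m, -, rfl⟩ := hγ
  exact isBigO_chebyshev_logSingRight_of_nat m hμ hg

/-! ### Reflection of the singularity at `x = -1`, and assembly -/

lemma chebyshevIntegrand_comp_neg (f : ℝ → ℝ) (k : ℕ) (x : ℝ) :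
    chebyshevIntegrand (fun y => f (-y)) k x = (-1) ^ k * chebyshevIntegrand f k (-x) := by
  have h1 : ((-1 : ℝ) ^ k) * (-1) ^ k = 1 := by rw [← mul_pow]; simp
  have h : (Polynomial.Chebyshev.T ℝ (k : ℤ)).eval (-x)
      = (-1) ^ k * (Polynomial.Chebyshev.T ℝ (k : ℤ)).eval x := by
    rw [Polynomial.Chebyshev.T_eval_neg]
    simp [Int.negOnePow_def]
  simp only [chebyshevIntegrand, h, neg_sq]
  linear_combination (-(f (-x) * (Polynomial.Chebyshev.T ℝ (k : ℤ)).eval x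
    * (1 / Real.sqrt (1 - x ^ 2)))) * h1

lemma intervalIntegrable_chebyshevIntegrand_comp_neg {f : ℝ → ℝ} {k : ℕ}
    (h : IntervalIntegrable (chebyshevIntegrand f k) MeasureTheory.volume (-1) 1) :
    IntervalIntegrable (chebyshevIntegrand (fun y => f (-y)) k) MeasureTheory.volume (-1) 1 := by
  have h2 := (h.comp_sub_left 0).symm.const_mul ((-1) ^ k)
  simp only [zero_sub, neg_neg] at h2
  simpa only [funext (chebyshevIntegrand_comp_neg f k)] using h2

/-- The parity sign `(-1)^k` disappears in the norm, so bounds at `x = 1` transfer to `x = -1`. -/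
lemma norm_integral_chebyshevIntegrand_comp_neg (f : ℝ → ℝ) (k : ℕ) :
    ‖∫ x in (-1 : ℝ)..1, chebyshevIntegrand (fun y => f (-y)) k x‖ =
      ‖∫ x in (-1 : ℝ)..1, chebyshevIntegrand f k x‖ := by
  simp only [chebyshevIntegrand_comp_neg, intervalIntegral.integral_const_mul]
  rw [intervalIntegral.integral_comp_neg (fun x => chebyshevIntegrand f k x)]
  simp

lemma logSingularFun_eq (γ δ : ℝ) (μ : ℕ) (g₁ g₂ : ℝ → ℝ) (x : ℝ) :
    logSingularFun γ δ μ g₁ g₂ x =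
      logSingRight γ μ g₁ x + logSingRight δ μ (fun y => g₂ (-y)) (-x) := by
  simp [logSingularFun, logSingRight]

lemma chebyshevIntegrand_logSingularFun (γ δ : ℝ) (μ : ℕ) (g₁ g₂ : ℝ → ℝ) (k : ℕ) :
    chebyshevIntegrand (logSingularFun γ δ μ g₁ g₂) k = fun x =>
      chebyshevIntegrand (logSingRight γ μ g₁) k x +
        chebyshevIntegrand (fun y => logSingRight δ μ (fun z => g₂ (-z)) (-y)) k x := by
  ext x
  simp only [chebyshevIntegrand, logSingularFun_eq]
  ring

lemma analyticOn_comp_neg {g : ℝ → ℝ} (hg : AnalyticOn ℝ g (Set.Icc (-1) 1)) :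
    AnalyticOn ℝ (fun y => g (-y)) (Set.Icc (-1) 1) :=
  have h : Set.MapsTo (fun y : ℝ => -y) (Set.Icc (-1) 1) (Set.Icc (-1) 1) := fun x hx =>
    ⟨by linarith [hx.2], by linarith [hx.1]⟩
  hg.comp analyticOn_id.neg h

/-- Endpoint bounds for the two integrals combine into one for the Chebyshev coefficient. -/
lemma isBigO_chebyshevCoeff_logSingularFun {γ δ : ℝ} (hγ : -(1 / 2 : ℝ) < γ)
    (hδ : -(1 / 2 : ℝ) < δ) (μ : ℕ) {g₁ g₂ : ℝ → ℝ}
    (hg₁ : AnalyticOn ℝ g₁ (Set.Icc (-1) 1)) (hg₂ : AnalyticOn ℝ g₂ (Set.Icc (-1) 1))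
    {u₁ u₂ u : ℕ → ℝ}
    (h₁ : (fun k : ℕ => ∫ x in (-1 : ℝ)..1, chebyshevIntegrand (logSingRight γ μ g₁) k x)
      =O[atTop] u₁)
    (h₂ : (fun k : ℕ => ∫ x in (-1 : ℝ)..1,
      chebyshevIntegrand (logSingRight δ μ (fun y => g₂ (-y))) k x) =O[atTop] u₂)
    (hu₁ : u₁ =O[atTop] u) (hu₂ : u₂ =O[atTop] u) :
    (fun k : ℕ => |chebyshevCoeff (logSingularFun γ δ μ g₁ g₂) k|) =O[atTop] u := by
  have h₂' : (fun k : ℕ => ∫ x in (-1 : ℝ)..1,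
      chebyshevIntegrand (fun y => logSingRight δ μ (fun z => g₂ (-z)) (-y)) k x) =O[atTop] u₂ := by
    rw [← isBigO_norm_left] at h₂ ⊢
    simpa only [norm_integral_chebyshevIntegrand_comp_neg] using h₂
  refine (((h₁.trans hu₁).add (h₂'.trans hu₂)).const_mul_left (2 / Real.pi)).norm_left.congr_left
    fun k => ?_
  rw [Real.norm_eq_abs, chebyshevCoeff, chebyshevIntegrand_logSingularFun,
    intervalIntegral.integral_add
      (intervalIntegrable_chebyshevIntegrand_logSingRight hγ μ hg₁ k)
      (intervalIntegrable_chebyshevIntegrand_comp_neg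
        (intervalIntegrable_chebyshevIntegrand_logSingRight hδ μ (analyticOn_comp_neg hg₂) k))]

lemma isBigO_log_pow_div_rpow_of_le (n : ℕ) {a b : ℝ} (h : b ≤ a) :
    (fun k : ℕ => Real.log k ^ n / (k : ℝ) ^ a) =O[atTop]
      fun k : ℕ => Real.log k ^ n / (k : ℝ) ^ b := by
  refine IsBigO.of_bound 1 ?_
  filter_upwards [eventually_ge_atTop 1] with k hk
  have hk1 : (1 : ℝ) ≤ k := by exact_mod_cast hk
  have hk0 : (0 : ℝ) < k := by linarith
  have hl : 0 ≤ Real.log k := Real.log_nonneg hk1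
  rw [one_mul, Real.norm_of_nonneg (by positivity), Real.norm_of_nonneg (by positivity)]
  gcongr

lemma isBigO_max_left_right {u v : ℕ → ℝ} (hu : ∀ᶠ k in atTop, 0 ≤ u k)
    (hv : ∀ᶠ k in atTop, 0 ≤ v k) :
    u =O[atTop] (fun k => max (u k) (v k)) ∧ v =O[atTop] (fun k => max (u k) (v k)) := by
  constructor <;> refine IsBigO.of_bound 1 ?_ <;> filter_upwards [hu, hv] with k h1 h2
  · rw [one_mul, Real.norm_of_nonneg h1, Real.norm_of_nonneg (h1.trans (le_max_left _ _))]
    exact le_max_left _ _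
  · rw [one_mul, Real.norm_of_nonneg h2, Real.norm_of_nonneg (h1.trans (le_max_left _ _))]
    exact le_max_right _ _

lemma log_pow_div_rpow_nonneg (n : ℕ) (a : ℝ) :
    ∀ᶠ k : ℕ in atTop, 0 ≤ Real.log k ^ n / (k : ℝ) ^ a :=
  Eventually.of_forall fun k => div_nonneg (pow_nonneg (Real.log_natCast_nonneg k) n)
    (Real.rpow_nonneg k.cast_nonneg a)

theorem mainTheorem5 (γ δ : ℝ) (hγ : -(1 / 2 : ℝ) < γ) (hδ : -(1 / 2 : ℝ) < δ)
    (μ : ℕ) (hμ : 0 < μ) (g₁ g₂ : ℝ → ℝ)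
    (hg₁ : AnalyticOn ℝ g₁ (Set.Icc (-1) 1)) (hg₂ : AnalyticOn ℝ g₂ (Set.Icc (-1) 1)) :
    (∀ k : ℕ, IntervalIntegrable (chebyshevIntegrand (logSingularFun γ δ μ g₁ g₂) k)
      MeasureTheory.volume (-1) 1) ∧
    (¬ IsPosInteger γ → ¬ IsPosInteger δ →
      (fun k : ℕ => |chebyshevCoeff (logSingularFun γ δ μ g₁ g₂) k|) =O[atTop]
        fun k : ℕ => Real.log k ^ μ / (k : ℝ) ^ min (2 * γ + 1) (2 * δ + 1)) ∧
    (IsPosInteger γ → IsPosInteger δ →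
      (fun k : ℕ => |chebyshevCoeff (logSingularFun γ δ μ g₁ g₂) k|) =O[atTop]
        fun k : ℕ => Real.log k ^ (μ - 1) / (k : ℝ) ^ min (2 * γ + 1) (2 * δ + 1)) ∧
    (IsPosInteger γ → ¬ IsPosInteger δ →
      (fun k : ℕ => |chebyshevCoeff (logSingularFun γ δ μ g₁ g₂) k|) =O[atTop]
        fun k : ℕ => max (Real.log k ^ (μ - 1) / (k : ℝ) ^ (2 * γ + 1))
          (Real.log k ^ μ / (k : ℝ) ^ (2 * δ + 1))) ∧
    (¬ IsPosInteger γ → IsPosInteger δ →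
      (fun k : ℕ => |chebyshevCoeff (logSingularFun γ δ μ g₁ g₂) k|) =O[atTop]
        fun k : ℕ => max (Real.log k ^ μ / (k : ℝ) ^ (2 * γ + 1))
          (Real.log k ^ (μ - 1) / (k : ℝ) ^ (2 * δ + 1))) := by
  have hg₂' := analyticOn_comp_neg hg₂
  have hA := isBigO_chebyshev_logSingRight hγ μ hg₁
  have hB := isBigO_chebyshev_logSingRight hδ μ hg₂'
  have hA' := fun h : IsPosInteger γ => isBigO_chebyshev_logSingRight_of_isPosInteger h hμ hg₁
  have hB' := fun h : IsPosInteger δ => isBigO_chebyshev_logSingRight_of_isPosInteger h hμ hg₂'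
  refine ⟨fun k => ?_, fun _ _ => ?_, fun h1 h2 => ?_, fun h1 _ => ?_, fun _ h2 => ?_⟩
  · rw [chebyshevIntegrand_logSingularFun]
    exact (intervalIntegrable_chebyshevIntegrand_logSingRight hγ μ hg₁ k).add
      (intervalIntegrable_chebyshevIntegrand_comp_neg
        (intervalIntegrable_chebyshevIntegrand_logSingRight hδ μ hg₂' k))
  · exact isBigO_chebyshevCoeff_logSingularFun hγ hδ μ hg₁ hg₂ hA hB
      (isBigO_log_pow_div_rpow_of_le μ (min_le_left _ _))
      (isBigO_log_pow_div_rpow_of_le μ (min_le_right _ _))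
  · exact isBigO_chebyshevCoeff_logSingularFun hγ hδ μ hg₁ hg₂ (hA' h1) (hB' h2)
      (isBigO_log_pow_div_rpow_of_le _ (min_le_left _ _))
      (isBigO_log_pow_div_rpow_of_le _ (min_le_right _ _))
  · have h := isBigO_max_left_right (log_pow_div_rpow_nonneg (μ - 1) (2 * γ + 1))
      (log_pow_div_rpow_nonneg μ (2 * δ + 1))
    exact isBigO_chebyshevCoeff_logSingularFun hγ hδ μ hg₁ hg₂ (hA' h1) hB h.1 h.2
  · have h := isBigO_max_left_right (log_pow_div_rpow_nonneg μ (2 * γ + 1))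
      (log_pow_div_rpow_nonneg (μ - 1) (2 * δ + 1))
    exact isBigO_chebyshevCoeff_logSingularFun hγ hδ μ hg₁ hg₂ hA (hB' h2) h.1 h.2
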